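/- Let $\mathcal F(f)(\xi)=\int_{\mathbf R^2} f(x)e^{-2\pi i\langle x,\xi\rangle}\,dx$ denote the Fourier transform on the plane (for radial $f$ the sign in the exponent is immaterial), and for a radial function $f$ on $\mathbf R^2$ let $\frac{df}{du}$ denote its derivative with respect to $u=|x|^2\ge 0$ (one-sided at $u=0$). Say that $f$ vanishes to order $2$ at the radius $r\ge 0$ if $f$ and $\frac{df}{du}$ both vanish at $|x|=r$. Let $R$ be the set of all radii $\sqrt{2n/\sqrt3}$, where $n=x^2+xy+y^2$ for some $x,y\in\mathbf Z$. (1) There is an infinite sequence of radial Schwartz functions $f_i:\mathbf R^2\to\mathbf C$, $i\in\mathbf N$, linearly independent over $\mathbf C$, such that for every $i$ both $f_i$ and $\mathcal F(f_i)$ vanish to order $2$ at every radius $r\in R$. (2) Consequently (Conjecture 7.5 of Cohn–Kumar–Miller–Radchenko–Viazovska) real-valued radial Schwartz functions on $\mathbf R^2$ are not uniquely determined by the values of $f$, $\mathcal F(f)$, $\frac{df}{du}$ and $\frac{d\mathcal F(f)}{du}$ at the positive radii in $R$: there are real-valued radial Schwartz functions $f\neq g$ on $\mathbf R^2$ such that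 $f(r)=g(r)$, $\mathcal F(f)(r)=\mathcal F(g)(r)$, $\frac{df}{du}(r)=\frac{dg}{du}(r)$ and $\frac{d\mathcal F(f)}{du}(r)=\frac{d\mathcal F(g)}{du}(r)$ for every $r\in R$ with $r>0$. -/

import Mathlib

open scoped FourierTransform SchwartzMap

/-- The Euclidean plane. -/
abbrev Plane : Type := EuclideanSpace ℝ (Fin 2)

/-- A function on the plane is radial if its value at a point depends only on the Euclidean norm
of the point. -/
def IsRadial (f : 𝓢(Plane, ℂ)) : Prop :=
  ∀ x y : Plane, ‖x‖ = ‖y‖ → f x = f y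

/-- The function takes only real values. -/
def IsRealValued (f : 𝓢(Plane, ℂ)) : Prop :=
  ∀ x : Plane, (f x).im = 0

/-- The profile of a radial function in the variable `u = |x|²` (meaningful for `0 ≤ u`):
the value of `f` at a point of norm `√u`. -/
noncomputable def profile (f : 𝓢(Plane, ℂ)) (u : ℝ) : ℂ :=
  f (EuclideanSpace.single 0 (Real.sqrt u))

/-- A radial function is recovered from its profile. -/
theorem IsRadial.eq_profile {f : 𝓢(Plane, ℂ)} (hf : IsRadial f) (x : Plane) :
    f x = profile f (‖x‖ ^ 2) := by
  apply hf
  simp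

/-- A radial function `f` vanishes to order (at least) two at the radius `r ≥ 0`: the value of `f`
and its derivative `df/du`, where `u = |x|²`, both vanish at `|x| = r`. The derivative is
taken within `u ≥ 0`; for `r > 0` it is the ordinary derivative, and its vanishing is equivalent to
that of `df/dr`, while at `r = 0` it is the one-sided derivative (and then the condition is
stronger than the one with `df/dr`, which would only say `f 0 = 0`). -/
def VanishesToOrderTwoAt (f : 𝓢(Plane, ℂ)) (r : ℝ) : Prop :=
  profile f (r ^ 2) = 0 ∧ HasDerivWithinAt (profile f) 0 (Set.Ici 0) (r ^ 2)

/-- The radii `√(2n/√3)`, where `n = x² + xy + y²` with `x, y` integers: the lengths of the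
vectors of the hexagonal lattice of covolume one. -/
def hexRadii : Set ℝ :=
  {r | ∃ x y : ℤ, r = Real.sqrt (2 * ((x ^ 2 + x * y + y ^ 2 : ℤ) : ℝ) / Real.sqrt 3)}

/-- `f` and `g` have the same value and the same derivative `d/du`, `u = |x|²`, at the radius
`r > 0`. (Profiles of radial Schwartz functions are differentiable at every `u > 0`.) -/
def SameFirstOrderDataAt (f g : 𝓢(Plane, ℂ)) (r : ℝ) : Prop :=
  profile f (r ^ 2) = profile g (r ^ 2) ∧ deriv (profile f) (r ^ 2) = deriv (profile g) (r ^ 2)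

/-! Functions with `𝓕 f = f` are sought, so that the conditions on `f` and on `𝓕 f` coincide. Write
`u_n = 2n/√3` and `b(θ) = π(1/10 - i√3 θ/48)`. At `u = u_n` the Gaussian `exp(-b(θ) u)` equals
`exp(-π u_n/10)` times the character `exp(2πi nθ/48)`. For a superposition with density `h` on
`[-26, 26]`, the value and the derivative at `u_n` therefore amount to the zeroth and first moments
of `h` against that character.

Numbers `x² + xy + y²` are never 2 modulo 3 or modulo 4, which leaves 24 of the 48 residues modulo
48. With two conditions per node, an interval of length 52 has room to prescribe all these moments
independently, even with one more residue class added: `exists_bounded_biorthogonal` gives a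
uniformly bounded biorthogonal system.

In the plane the Gaussian of rate `b` transforms into `π/b` times the one of rate `π²/b`, and
`Re(π²/b) > Re b` exactly when `|b| < π`. This holds for `|θ| ≤ 26` because 26 < 48/√3 ≈ 27.7
(`le_dualRate_re`). Adding the Fourier transform, which makes the function self-dual, thus changes
the normalized data at `u_n` by functionals exponentially small in `n`
(`exists_norm_dualKernel_le`). A Neumann series absorbs this perturbation outside a finite set of
nodes. The values on the added residue class stay free; this gives infinitely many parameters,
enough to meet the finitely many remaining conditions and keep an infinite-dimensional family
(`exists_linearIndependent_data`). -/

open scoped BoundedContinuousFunction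

/-! ### Perturbation of biorthogonal systems of functionals. -/

section Perturbation

variable {ι X : Type*} [NormedAddCommGroup X] [NormedSpace ℂ X] [CompleteSpace X]

/-- A biorthogonal system `(T, e)` stays solvable after a small perturbation of the functionals. -/
theorem exists_solution_of_perturbation (T S : ι → X →L[ℂ] ℂ) (e : ι → X)
    (h1 : ∀ i, T i (e i) = 1) (h0 : ∀ i j, i ≠ j → T i (e j) = 0)
    (hs : Summable fun i => ‖S i‖ * ‖e i‖) (hlt : ∑' i, ‖S i‖ * ‖e i‖ < 1) (y : X) :
    ∃ x : X, ∀ i, T i x + S i x = T i y := by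
  have hn : ∀ i, ‖(S i).smulRight (e i)‖ = ‖S i‖ * ‖e i‖ :=
    fun i => ContinuousLinearMap.norm_smulRight_apply _ _
  have hs' : Summable fun i => ‖(S i).smulRight (e i)‖ := by simpa only [hn] using hs
  have hS : Summable fun i => (S i).smulRight (e i) := hs'.of_norm
  -- Biorthogonality gives `T i ∘ R = S i`, so `T i + S i = T i ∘ (1 + R)`, and `1 + R` is
  -- invertible once `‖R‖ < 1`.
  set R : X →L[ℂ] X := ∑' i, (S i).smulRight (e i) with hR
  have hRn : ‖-R‖ < 1 := by
    rw [norm_neg]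
    refine lt_of_le_of_lt (norm_tsum_le_tsum_norm hs') ?_
    simpa only [hn] using hlt
  have hTR : ∀ i x, T i (R x) = S i x := by
    intro i x
    have hsum : HasSum (fun j => S j x • e j) (R x) := by
      have := hS.hasSum.mapL (ContinuousLinearMap.apply ℂ X x)
      simpa using this
    have h2 := hsum.mapL (T i)
    have h3 : HasSum (fun j => T i (S j x • e j)) (T i (S i x • e i)) := by
      refine hasSum_single i fun j hj => ?_
      simp [h0 i j (Ne.symm hj)]
    rw [h2.unique h3]
    simp [h1]
  set u := Units.oneSub (-R) hRn with hu
  refine ⟨(↑u⁻¹ : X →L[ℂ] X) y, fun i => ?_⟩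
  have hmul : ((u : X →L[ℂ] X) * (↑u⁻¹ : X →L[ℂ] X)) y = y := by simp
  have hval : (u : X →L[ℂ] X) = 1 + R := by rw [hu, Units.val_oneSub, sub_neg_eq_add]
  rw [hval, mul_apply_eq_comp, add_apply,
    one_apply_eq_self] at hmul
  rw [← hTR, ← map_add, hmul]

/-- An infinite-dimensional complex vector space contains a linearly independent sequence. -/
theorem exists_linearIndependent_nat {V : Type*} [AddCommGroup V] [Module ℂ V]
    (hV : ¬ Module.Finite ℂ V) : ∃ v : ℕ → V, LinearIndependent ℂ v := by
  let B := Module.Basis.ofVectorSpace ℂ V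
  have : Infinite (Module.Basis.ofVectorSpaceIndex ℂ V) := by
    by_contra h
    rw [not_infinite_iff_finite] at h
    exact hV (Module.Finite.of_basis B)
  exact ⟨fun n => B (Infinite.natEmbedding _ n),
    B.linearIndependent.comp _ (Infinite.natEmbedding _).injective⟩

/-- If the functionals `T i` have a biorthogonal system `e` and the `S i` are summably small
against it, then infinitely many linearly independent data vectors supported on a given
infinite index set are attained by `T + S`. -/
theorem exists_linearIndependent_data (T S : ι → X →L[ℂ] ℂ) (e : ι → X)
    (h1 : ∀ i, T i (e i) = 1) (h0 : ∀ i j, i ≠ j → T i (e j) = 0)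
    (hs : Summable fun i => ‖S i‖ * ‖e i‖) (E : Set ι) (hE : E.Infinite) :
    ∃ x : ℕ → X, LinearIndependent ℂ (fun k (i : E) => T i (x k) + S i (x k)) ∧
      ∀ k, ∀ i ∉ E, T i (x k) + S i (x k) = 0 := by
  classical
  -- Only a tail of the sum is below 1; the finitely many indices in `s` are set aside and treated
  -- by linear algebra.
  obtain ⟨s, hslt⟩ : ∃ s : Finset ι, ∑' i : {i // i ∉ s}, ‖S i‖ * ‖e i‖ < 1 :=
    ((tendsto_order.1 (tendsto_tsum_compl_atTop_zero fun i => ‖S i‖ * ‖e i‖)).2 1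
      zero_lt_one).exists
  have hsol : ∀ y : X, ∃ x : X, ∀ i : {i // i ∉ s}, T i x + S i x = T i y :=
    exists_solution_of_perturbation (fun i : {i // i ∉ s} => T i) (fun i => S i) (fun i => e i)
      (fun i => h1 i) (fun i j hij => h0 i j fun h => hij (Subtype.ext h))
      (hs.comp_injective Subtype.coe_injective) hslt
  choose x hx using fun i : ι => hsol (e i)
  have hxs : ∀ i ∉ s, ∀ k, T i (x k) + S i (x k) = if i = k then 1 else 0 := by
    intro i hi k
    rw [hx k ⟨i, hi⟩]
    split_ifs with h
    · subst h; exact h1 _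
    · exact h0 _ _ h
  let J : Set ι := E \ s
  have hJ : J.Infinite := hE.sdiff s.finite_toSet
  have : Infinite J := hJ.to_subtype
  let φ : (J →₀ ℂ) →ₗ[ℂ] X := Finsupp.linearCombination ℂ fun k : J => x k
  let D : X →ₗ[ℂ] (ι → ℂ) := LinearMap.pi fun i => ((T i + S i : X →L[ℂ] ℂ) : X →ₗ[ℂ] ℂ)
  have hDa : ∀ y i, D y i = T i y + S i y := fun y i => rfl
  have hDφ : ∀ v, ∀ i ∉ s, D (φ v) i = v.sum fun k c => c * if i = (k : ι) then 1 else 0 := by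
    intro v i hi
    have : D (φ v) i = ((LinearMap.proj i).comp D) (φ v) := rfl
    rw [this, Finsupp.apply_linearCombination, Finsupp.linearCombination_apply]
    refine Finsupp.sum_congr fun k _ => ?_
    simp only [Function.comp_apply, LinearMap.comp_apply, LinearMap.proj_apply, smul_eq_mul, hDa]
    rw [hxs i hi]
  have hDJ : ∀ v, ∀ k : J, D (φ v) k = v k := by
    intro v k
    rw [hDφ v k k.2.2, Finsupp.sum]
    simp only [mul_ite, mul_one, mul_zero, Subtype.coe_inj]
    simpa using fun h => h.symm
  have hD0 : ∀ v, ∀ i ∉ s, i ∉ E → D (φ v) i = 0 := by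
    intro v i hi hiE
    rw [hDφ v i hi]
    refine Finset.sum_eq_zero fun k _ => ?_
    have : i ≠ k := fun h => hiE (h ▸ k.2.1)
    simp [this]
  -- `ψ` records the data at the indices set aside. Its target is finite-dimensional, so its kernel
  -- is still infinite-dimensional.
  let ψ : (J →₀ ℂ) →ₗ[ℂ] (s → ℂ) := (LinearMap.funLeft ℂ ℂ fun i : s => (i : ι)).comp (D.comp φ)
  have hker : ¬ Module.Finite ℂ (LinearMap.ker ψ) := by
    intro hfin
    have h2 : Module.Finite ℂ ((J →₀ ℂ) ⧸ LinearMap.ker ψ) :=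
      Module.Finite.equiv ψ.quotKerEquivRange.symm
    have h3 : Module.Finite ℂ (J →₀ ℂ) := Module.Finite.of_submodule_quotient (LinearMap.ker ψ)
    have h4 := Module.Finite.finite_basis (Finsupp.basisSingleOne (R := ℂ) (ι := J))
    exact not_finite J
  obtain ⟨v, hv⟩ := exists_linearIndependent_nat (V := LinearMap.ker ψ) hker
  refine ⟨fun k => φ (v k), ?_, ?_⟩
  · let Φ : LinearMap.ker ψ →ₗ[ℂ] (E → ℂ) :=
      (LinearMap.funLeft ℂ ℂ fun i : E => (i : ι)).comp ((D.comp φ).comp (LinearMap.ker ψ).subtype)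
    refine hv.map' Φ ?_
    rw [LinearMap.ker_eq_bot']
    intro w hw
    ext k
    have := congrFun hw ⟨k, k.2.1⟩
    rw [← hDJ w k]
    exact this
  · intro k i hi
    by_cases his : i ∈ s
    · exact congrFun (v k).2 ⟨i, his⟩
    · exact hD0 _ i his hi

end Perturbation

/-! ### Superpositions of exponentials in the variable `u`. -/

/-- The superposition `u ↦ ∫ c(θ) exp(-b(θ) u) dθ` over `|θ| ≤ L`. -/
noncomputable def laplaceInt (L : ℝ) (b c : ℝ → ℂ) (u : ℝ) : ℂ :=
  ∫ θ in (-L)..L, c θ * Complex.exp (-b θ * u)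

theorem exists_norm_le_on_uIoc (L : ℝ) {c : ℝ → ℂ} (hc : Continuous c) :
    ∃ C : ℝ, 0 ≤ C ∧ ∀ θ ∈ Set.uIoc (-L) L, ‖c θ‖ ≤ C := by
  obtain ⟨C, hC⟩ := (isCompact_uIcc (a := -L) (b := L)).exists_bound_of_continuousOn
    hc.continuousOn
  exact ⟨max C 0, le_max_right _ _, fun θ hθ =>
    (hC θ (Set.uIoc_subset_uIcc hθ)).trans (le_max_left _ _)⟩

open MeasureTheory in
theorem hasDerivAt_laplaceInt (L : ℝ) {b c : ℝ → ℂ} (hb : Continuous b) (hc : Continuous c)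
    (u : ℝ) : HasDerivAt (laplaceInt L b c) (laplaceInt L b (fun θ => -b θ * c θ) u) u := by
  obtain ⟨B, hB0, hB⟩ := exists_norm_le_on_uIoc L hb
  obtain ⟨C, hC0, hC⟩ := exists_norm_le_on_uIoc L hc
  refine (intervalIntegral.hasDerivAt_integral_of_dominated_loc_of_deriv_le
    (𝕜 := ℝ) (s := Metric.ball u 1) (x₀ := u) (μ := volume) (a := -L) (b := L)
    (F := fun (u : ℝ) θ => c θ * Complex.exp (-b θ * (u : ℂ)))
    (F' := fun (u : ℝ) θ => -b θ * c θ * Complex.exp (-b θ * (u : ℂ)))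
    (bound := fun _ => B * C * Real.exp (B * (|u| + 1)))
    (Metric.ball_mem_nhds u one_pos) (Filter.Eventually.of_forall fun v => ?_) ?_ ?_ ?_ ?_ ?_).2
  · exact (by fun_prop : Continuous _).aestronglyMeasurable
  · exact (by fun_prop : Continuous _).intervalIntegrable _ _
  · exact (by fun_prop : Continuous _).aestronglyMeasurable
  · refine Filter.Eventually.of_forall fun θ hθ v hv => ?_
    rw [norm_mul, norm_mul, norm_neg]
    have hv' : ‖(v : ℂ)‖ ≤ |u| + 1 := by
      rw [Complex.norm_real, Real.norm_eq_abs]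
      rw [Metric.mem_ball, Real.dist_eq] at hv
      have := abs_sub_abs_le_abs_sub v u
      linarith
    have h3 : ‖Complex.exp (-b θ * (v : ℂ))‖ ≤ Real.exp (B * (|u| + 1)) := by
      refine (Complex.norm_exp_le_exp_norm _).trans (Real.exp_le_exp.2 ?_)
      rw [norm_mul, norm_neg]
      exact mul_le_mul (hB θ hθ) hv' (norm_nonneg _) hB0
    exact mul_le_mul (mul_le_mul (hB θ hθ) (hC θ hθ) (norm_nonneg _) hB0) h3 (norm_nonneg _)
      (by positivity)
  · exact intervalIntegrable_const
  · refine Filter.Eventually.of_forall fun θ _ v _ => ?_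
    have h := ((Complex.ofRealCLM.hasDerivAt (x := v)).const_mul (-b θ)).cexp.const_mul (c θ)
    refine h.congr_deriv ?_
    simp
    ring

theorem iteratedDeriv_laplaceInt (L : ℝ) {b : ℝ → ℂ} (hb : Continuous b) (n : ℕ) {c : ℝ → ℂ}
    (hc : Continuous c) :
    iteratedDeriv n (laplaceInt L b c) = laplaceInt L b (fun θ => (-b θ) ^ n * c θ) := by
  induction n with
  | zero => simp [iteratedDeriv_zero]
  | succ n ih =>
    rw [iteratedDeriv_succ, ih]
    funext u
    rw [(hasDerivAt_laplaceInt L hb (by fun_prop) u).deriv]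
    congr 1
    funext θ
    ring

theorem contDiff_laplaceInt (L : ℝ) {b c : ℝ → ℂ} (hb : Continuous b) (hc : Continuous c) :
    ContDiff ℝ (⊤ : ℕ∞) (laplaceInt L b c) := by
  refine contDiff_of_differentiable_iteratedDeriv fun m _ => ?_
  rw [iteratedDeriv_laplaceInt L hb m hc]
  exact fun u => (hasDerivAt_laplaceInt L hb (by fun_prop) u).differentiableAt

theorem norm_laplaceInt_le (L : ℝ) {b c : ℝ → ℂ} {σ C : ℝ}
    (hσ : ∀ θ ∈ Set.uIoc (-L) L, σ ≤ (b θ).re)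
    (hC : ∀ θ ∈ Set.uIoc (-L) L, ‖c θ‖ ≤ C) {u : ℝ} (hu : 0 ≤ u) :
    ‖laplaceInt L b c u‖ ≤ C * |L - -L| * Real.exp (-σ * u) := by
  have h : ∀ θ ∈ Set.uIoc (-L) L, ‖c θ * Complex.exp (-b θ * u)‖ ≤ C * Real.exp (-σ * u) := by
    intro θ hθ
    rw [norm_mul, Complex.norm_exp]
    refine mul_le_mul (hC θ hθ) (Real.exp_le_exp.2 ?_) (Real.exp_pos _).le
      ((norm_nonneg _).trans (hC θ hθ))
    simp only [Complex.mul_re, Complex.neg_re, Complex.neg_im, Complex.ofReal_re,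
      Complex.ofReal_im, mul_zero, sub_zero]
    exact mul_le_mul_of_nonneg_right (neg_le_neg (hσ θ hθ)) hu
  refine (intervalIntegral.norm_integral_le_of_norm_le_const h).trans (le_of_eq ?_)
  ring

/-! ### Schwartz functions of `‖x‖²` and their Fourier transforms. -/

section RadialSchwartz

variable {E : Type*} [NormedAddCommGroup E] [InnerProductSpace ℝ E]

theorem norm_fderiv_norm_sq_le (x : E) : ‖fderiv ℝ (fun x : E => ‖x‖ ^ 2) x‖ ≤ 2 * ‖x‖ := by
  rw [fderiv_norm_sq]
  rw [Pi.smul_apply]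
  refine (norm_nsmul_le).trans ?_
  simp

theorem norm_iteratedFDeriv_norm_sq_le (x : E) {i : ℕ} (hi : 1 ≤ i) :
    ‖iteratedFDeriv ℝ i (fun x : E => ‖x‖ ^ 2) x‖ ≤ (2 * (1 + ‖x‖)) ^ i := by
  have hf : fderiv ℝ (fun x : E => ‖x‖ ^ 2) = ((2 : ℝ) • innerSL ℝ : E →L[ℝ] E →L[ℝ] ℝ) := by
    funext y
    rw [fderiv_norm_sq]
    ext z
    simp
  have hx := norm_nonneg x
  obtain ⟨j, rfl⟩ : ∃ j, i = j + 1 := ⟨i - 1, by omega⟩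
  rw [← norm_iteratedFDeriv_fderiv]
  have hN : ‖((2 : ℝ) • innerSL ℝ : E →L[ℝ] E →L[ℝ] ℝ)‖ ≤ 2 := by
    refine ContinuousLinearMap.opNorm_le_bound _ zero_le_two fun y => ?_
    rw [← hf]
    exact norm_fderiv_norm_sq_le y
  have h1 : (1 : ℝ) ≤ 2 * (1 + ‖x‖) := by linarith
  -- The squared norm is quadratic: only its first two derivatives need an estimate, and those of
  -- order at least three vanish.
  match j with
  | 0 =>
    rw [norm_iteratedFDeriv_zero]
    refine (norm_fderiv_norm_sq_le x).trans ?_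
    simp
  | 1 =>
    rw [← norm_iteratedFDeriv_fderiv, norm_iteratedFDeriv_zero, hf, ContinuousLinearMap.fderiv]
    refine hN.trans ?_
    rw [one_add_one_eq_two]
    nlinarith
  | j + 2 =>
    have hc : fderiv ℝ ((2 : ℝ) • innerSL ℝ : E →L[ℝ] E →L[ℝ] ℝ) =
        fun _ => ((2 : ℝ) • innerSL ℝ : E →L[ℝ] E →L[ℝ] ℝ) :=
      funext fun y => ContinuousLinearMap.fderiv _
    rw [← norm_iteratedFDeriv_fderiv, hf, hc, iteratedFDeriv_succ_const]
    simp only [Pi.zero_apply, norm_zero]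
    positivity

/-- A smooth function of `‖x‖²` all of whose derivatives decay exponentially is Schwartz. -/
theorem exists_schwartzMap_comp_norm_sq {F : Type*} [NormedAddCommGroup F] [NormedSpace ℝ F]
    {Φ : ℝ → F} (hΦ : ContDiff ℝ (⊤ : ℕ∞) Φ) {σ : ℝ} (hσ : 0 < σ)
    (hd : ∀ n, ∃ C, ∀ u, 0 ≤ u → ‖iteratedDeriv n Φ u‖ ≤ C * Real.exp (-σ * u)) :
    ∃ g : 𝓢(E, F), ∀ x, g x = Φ (‖x‖ ^ 2) := by
  have hq : ContDiff ℝ (⊤ : ℕ∞) fun x : E => ‖x‖ ^ 2 := contDiff_norm_sq ℝ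
  refine ⟨⟨fun x => Φ (‖x‖ ^ 2), hΦ.comp hq, fun k n => ?_⟩, fun x => rfl⟩
  choose C hC using hd
  have hC0 : ∀ i, 0 ≤ C i := fun i => by
    simpa using (norm_nonneg _).trans (hC i 0 le_rfl)
  set M := ∑ i ∈ Finset.range (n + 1), C i
  have hCM : ∀ i ≤ n, C i ≤ M := fun i hi =>
    Finset.single_le_sum (f := C) (fun j _ => hC0 j) (Finset.mem_range.2 (by omega))
  have hM : 0 ≤ M := Finset.sum_nonneg fun j _ => hC0 j
  obtain ⟨K, hK⟩ : ∃ K : ℝ, ∀ t : ℝ, 0 ≤ t →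
      (1 + t) ^ (k + n) * Real.exp (-σ * t ^ 2) ≤ K := by
    have hlim : Filter.Tendsto (fun t : ℝ => (1 + t) ^ (k + n) * Real.exp (-σ * (1 + t)))
        Filter.atTop (nhds 0) := by
      have h1 := tendsto_rpow_mul_exp_neg_mul_atTop_nhds_zero (k + n : ℕ) σ hσ
      have h2 := h1.comp (Filter.tendsto_atTop_add_const_left _ (1 : ℝ) Filter.tendsto_id)
      refine h2.congr fun t => ?_
      simp only [Function.comp_apply, id, Real.rpow_natCast]
    have hcont : Continuous fun t : ℝ => (1 + t) ^ (k + n) * Real.exp (-σ * (1 + t)) := by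
      fun_prop
    obtain ⟨A, hA⟩ := ((tendsto_order.1 hlim).2 1 one_pos).exists_forall_of_atTop
    obtain ⟨K, hK⟩ := (isCompact_Icc (a := 0) (b := A)).exists_bound_of_continuousOn
      hcont.continuousOn
    refine ⟨max K 1 * Real.exp (σ * 2), fun t ht => ?_⟩
    have h3 : (1 + t) ^ (k + n) * Real.exp (-σ * (1 + t)) ≤ max K 1 := by
      by_cases hAt : A ≤ t
      · exact (hA t hAt).le.trans (le_max_right _ _)
      · exact (le_abs_self _).trans ((hK t ⟨ht, by linarith⟩).trans (le_max_left _ _))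
    -- This is `t² ≥ t - 1`, from completing the square at 1/2.
    have h4 : Real.exp (-σ * t ^ 2) ≤ Real.exp (-σ * (1 + t)) * Real.exp (σ * 2) := by
      rw [← Real.exp_add]
      refine Real.exp_le_exp.2 ?_
      nlinarith [mul_nonneg hσ.le (sq_nonneg (t - 1 / 2))]
    calc _ ≤ (1 + t) ^ (k + n) * (Real.exp (-σ * (1 + t)) * Real.exp (σ * 2)) := by gcongr
      _ = (1 + t) ^ (k + n) * Real.exp (-σ * (1 + t)) * Real.exp (σ * 2) := by ring
      _ ≤ _ := by gcongr
  refine ⟨n.factorial * M * 2 ^ n * K, fun x => ?_⟩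
  have hx := norm_nonneg x
  have hb := norm_iteratedFDeriv_comp_le (n := n) hΦ hq (by exact_mod_cast le_top) x
    (C := M * Real.exp (-σ * ‖x‖ ^ 2)) (D := 2 * (1 + ‖x‖))
    (fun i hi => by
      rw [norm_iteratedFDeriv_eq_norm_iteratedDeriv]
      refine (hC i _ (sq_nonneg _)).trans ?_
      gcongr
      exact hCM i hi)
    (fun i hi _ => norm_iteratedFDeriv_norm_sq_le x hi)
  calc ‖x‖ ^ k * ‖iteratedFDeriv ℝ n (fun x => Φ (‖x‖ ^ 2)) x‖
      ≤ (1 + ‖x‖) ^ k * (n.factorial * (M * Real.exp (-σ * ‖x‖ ^ 2)) * (2 * (1 + ‖x‖)) ^ n) := by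
        gcongr
        · linarith
        · exact hb
    _ = n.factorial * M * 2 ^ n * ((1 + ‖x‖) ^ (k + n) * Real.exp (-σ * ‖x‖ ^ 2)) := by
        rw [mul_pow, pow_add]; ring
    _ ≤ _ := by
        gcongr
        exact hK _ hx

end RadialSchwartz

theorem exists_schwartzMap_laplaceInt {E : Type*} [NormedAddCommGroup E] [InnerProductSpace ℝ E]
    (L : ℝ) {b c : ℝ → ℂ} (hb : Continuous b) (hc : Continuous c) {σ : ℝ} (hσ : 0 < σ)
    (hbσ : ∀ θ ∈ Set.uIoc (-L) L, σ ≤ (b θ).re) :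
    ∃ g : 𝓢(E, ℂ), ∀ x, g x = laplaceInt L b c (‖x‖ ^ 2) := by
  refine exists_schwartzMap_comp_norm_sq (contDiff_laplaceInt L hb hc) hσ fun n => ?_
  obtain ⟨C, hC0, hC⟩ := exists_norm_le_on_uIoc L
    (by fun_prop : Continuous fun θ => (-b θ) ^ n * c θ)
  refine ⟨C * |L - -L|, fun u hu => ?_⟩
  rw [iteratedDeriv_laplaceInt L hb n hc]
  exact norm_laplaceInt_le L hbσ hC hu

open MeasureTheory in
/-- The Fourier transform in the plane of a superposition of Gaussians. -/
theorem fourier_laplaceInt (L : ℝ) (hL : 0 ≤ L) {b c : ℝ → ℂ} (hb : Continuous b)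
    (hc : Continuous c) {σ : ℝ}
    (hσ : 0 < σ) (hbσ : ∀ θ, σ ≤ (b θ).re) (ξ : Plane) :
    𝓕 (fun x : Plane => laplaceInt L b c (‖x‖ ^ 2)) ξ =
      laplaceInt L (fun θ => (Real.pi : ℂ) ^ 2 / b θ) (fun θ => c θ * (Real.pi / b θ))
        (‖ξ‖ ^ 2) := by
  have hLL : -L ≤ L := by linarith
  obtain ⟨C, hC0, hC⟩ := exists_norm_le_on_uIoc L hc
  have hgauss : ∀ θ, 𝓕 (fun x : Plane => Complex.exp (-b θ * ((‖x‖ ^ 2 : ℝ) : ℂ))) ξ =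
      (Real.pi / b θ) * Complex.exp (-((Real.pi : ℂ) ^ 2 / b θ) * ((‖ξ‖ ^ 2 : ℝ) : ℂ)) := by
    intro θ
    have h := fourier_gaussian_innerProductSpace (V := Plane) (b := b θ) (hσ.trans_le (hbσ θ)) ξ
    push_cast
    rw [h]
    have : ((Module.finrank ℝ Plane : ℂ) / 2) = 1 := by simp
    rw [this, Complex.cpow_one]
    congr 2
    ring
  rw [Real.fourier_eq]
  simp only [laplaceInt, intervalIntegral.integral_of_le hLL]
  simp only [Circle.smul_def, smul_eq_mul, ← integral_const_mul]
  rw [integral_integral_swap]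
  · refine integral_congr_ae (Filter.Eventually.of_forall fun θ => ?_)
    simp only
    rw [mul_assoc, ← hgauss θ, Real.fourier_eq, ← integral_const_mul]
    refine integral_congr_ae (Filter.Eventually.of_forall fun x => ?_)
    simp only [Circle.smul_def, smul_eq_mul]
    ring
  · have hint : Integrable (fun x : Plane => Real.exp (-σ * ‖x‖ ^ 2)) := by
      have := GaussianFourier.integrable_cexp_neg_mul_sq_norm_add (V := Plane) (b := (σ : ℂ))
        (by simpa using hσ) 0 0
      have := this.norm
      refine this.congr (Filter.Eventually.of_forall fun x => ?_)
      simp [Complex.norm_exp, ← Complex.ofReal_pow]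
    have hint2 : Integrable (fun z : Plane × ℝ => Real.exp (-σ * ‖z.1‖ ^ 2) * C)
        ((volume : Measure Plane).prod (volume.restrict (Set.Ioc (-L) L))) :=
      hint.mul_prod (integrable_const C)
    refine hint2.mono' ?_ ?_
    · refine Continuous.aestronglyMeasurable ?_
      simp only [Function.uncurry_def]
      have h1 : Continuous fun z : Plane × ℝ => (Real.fourierChar (-inner ℝ z.1 ξ) : ℂ) := by
        have := Real.continuous_fourierChar
        fun_prop
      fun_prop
    · have : ∀ᵐ z : Plane × ℝ ∂(volume : Measure Plane).prod
          (volume.restrict (Set.Ioc (-L) L)), z.2 ∈ Set.Ioc (-L) L :=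
        Measure.quasiMeasurePreserving_snd.ae (ae_restrict_mem measurableSet_Ioc)
      filter_upwards [this] with z hz
      rw [← Set.uIoc_of_le hLL] at hz
      simp only [Function.uncurry_def, norm_mul, Circle.norm_coe, one_mul, Complex.norm_exp]
      rw [mul_comm]
      refine mul_le_mul (Real.exp_le_exp.2 ?_) (hC _ hz) (norm_nonneg _) (Real.exp_pos _).le
      simp only [Complex.mul_re, Complex.neg_re, Complex.neg_im, Complex.ofReal_re,
        Complex.ofReal_im, mul_zero, sub_zero]
      exact mul_le_mul_of_nonneg_right (neg_le_neg (hbσ _)) (sq_nonneg _)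

/-! ### Pairings with continuous kernels, and Hermite interpolation. -/

/-- Integration of bounded continuous functions against a continuous kernel over `[-L, L]`. -/
noncomputable def kernelPairing (L : ℝ) (k : C(ℝ, ℂ)) : (ℝ →ᵇ ℂ) →L[ℂ] ℂ :=
  LinearMap.mkContinuousOfExistsBound
    { toFun := fun h => ∫ θ in (-L)..L, h θ * k θ
      map_add' := fun h g => by
        rw [← intervalIntegral.integral_add]
        · simp [add_mul]
        · exact (by fun_prop : Continuous _).intervalIntegrable _ _
        · exact (by fun_prop : Continuous _).intervalIntegrable _ _
      map_smul' := fun c h => by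
        rw [RingHom.id_apply, smul_eq_mul, ← intervalIntegral.integral_const_mul]
        simp [mul_assoc] }
    (by
      obtain ⟨C, hC0, hC⟩ := exists_norm_le_on_uIoc L k.continuous
      refine ⟨C * |L - -L|, fun h => ?_⟩
      have : ∀ θ ∈ Set.uIoc (-L) L, ‖h θ * k θ‖ ≤ C * ‖h‖ := fun θ hθ => by
        rw [norm_mul, mul_comm]
        exact mul_le_mul (hC θ hθ) (h.norm_coe_le_norm θ) (norm_nonneg _) hC0
      refine (intervalIntegral.norm_integral_le_of_norm_le_const this).trans (le_of_eq ?_)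
      ring)

theorem kernelPairing_apply (L : ℝ) (k : C(ℝ, ℂ)) (h : ℝ →ᵇ ℂ) :
    kernelPairing L k h = ∫ θ in (-L)..L, h θ * k θ := rfl

theorem norm_kernelPairing_le (L : ℝ) (k : C(ℝ, ℂ)) {C : ℝ} (hC0 : 0 ≤ C)
    (hC : ∀ θ ∈ Set.uIoc (-L) L, ‖k θ‖ ≤ C) : ‖kernelPairing L k‖ ≤ C * |L - -L| := by
  refine ContinuousLinearMap.opNorm_le_bound _ (by positivity) fun h => ?_
  have : ∀ θ ∈ Set.uIoc (-L) L, ‖h θ * k θ‖ ≤ C * ‖h‖ := fun θ hθ => by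
    rw [norm_mul, mul_comm]
    exact mul_le_mul (hC θ hθ) (h.norm_coe_le_norm θ) (norm_nonneg _) hC0
  refine (intervalIntegral.norm_integral_le_of_norm_le_const this).trans (le_of_eq ?_)
  ring

/-- Hermite interpolation at one point, with double zeros at finitely many other points. -/
theorem exists_polynomial_double_zeros (S : Finset ℂ) {z : ℂ} (hz : z ∉ S) (x y : ℂ) :
    ∃ p : Polynomial ℂ, p.natDegree ≤ 2 * S.card + 1 ∧ p.eval z = x ∧ p.derivative.eval z = y ∧
      ∀ s ∈ S, p.eval s = 0 ∧ p.derivative.eval s = 0 := by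
  classical
  open Polynomial in
  let q : ℂ[X] := ∏ s ∈ S, (X - C s)
  have hqz : q.eval z ≠ 0 := by
    rw [eval_prod]
    refine Finset.prod_ne_zero_iff.2 fun s hs => ?_
    rw [eval_sub, eval_X, eval_C, sub_ne_zero]
    exact fun h => hz (h ▸ hs)
  have hqs : ∀ s ∈ S, q.eval s = 0 := fun s hs => by
    rw [eval_prod]
    exact Finset.prod_eq_zero hs (by simp)
  have hdeg : q.natDegree = S.card := by simp [q]
  let α : ℂ := x / q.eval z ^ 2
  let β : ℂ := (y - α * (2 * q.eval z * q.derivative.eval z)) / q.eval z ^ 2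
  -- The factor `q ^ 2` forces the double zeros; the two coefficients of the linear factor fit the
  -- value and the derivative at `z`.
  refine ⟨(C α + C β * (X - C z)) * q ^ 2, ?_, ?_, ?_, fun s hs => ⟨?_, ?_⟩⟩
  · refine natDegree_mul_le.trans ?_
    have h1 : (C α + C β * (X - C z)).natDegree ≤ 1 := by compute_degree
    have h2 := natDegree_pow_le (p := q) (n := 2)
    rw [hdeg] at h2
    omega
  · simp only [eval_mul, eval_add, eval_C, eval_sub, eval_X, eval_pow, sub_self, mul_zero,
      add_zero]
    exact div_mul_cancel₀ _ (pow_ne_zero 2 hqz)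
  · simp only [derivative_mul, derivative_add, derivative_C, derivative_sub, derivative_X,
      derivative_pow, eval_mul, eval_add, eval_C, eval_sub, eval_X, eval_pow, sub_self, mul_zero,
      add_zero, zero_mul, zero_add, sub_zero, mul_one, Nat.cast_ofNat,
      Nat.add_one_sub_one, pow_one]
    have : β * q.eval z ^ 2 = y - α * (2 * q.eval z * q.derivative.eval z) :=
      div_mul_cancel₀ _ (pow_ne_zero 2 hqz)
    rw [this]
    ring
  · simp [hqs s hs]
  · simp [derivative_mul, derivative_pow, hqs s hs]

/-! ### Moments of the triangle function against characters. -/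

/-- The triangle function supported on `[-1, 1]`. -/
noncomputable def triangle (θ : ℝ) : ℝ := max 0 (1 - |θ|)

theorem continuous_triangle : Continuous triangle := by
  unfold triangle; fun_prop

theorem abs_triangle_le_one (θ : ℝ) : |triangle θ| ≤ 1 := by
  unfold triangle
  rw [abs_of_nonneg (le_max_left _ _)]
  exact max_le zero_le_one (by linarith [abs_nonneg θ])

/-- Folding both halves of the support onto `[0, 1]` gives the weights `1 - θ` and `θ`, whose sum is
1; the cancellations at multiples of 48 rest on this. -/
theorem integral_triangle_mul {L c : ℝ} (hc : |c| + 1 ≤ L) {φ : ℝ → ℂ} (hφ : Continuous φ) :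
    ∫ θ in (-L)..L, (triangle (θ - c) : ℂ) * φ θ =
      ∫ θ in (0 : ℝ)..1, ((1 - θ) * φ (θ + c) + θ * φ (θ - 1 + c)) := by
  have hc1 := neg_abs_le c
  have hc2 := le_abs_self c
  have hcont : Continuous fun θ : ℝ => (triangle (θ - c) : ℂ) * φ θ := by
    have := continuous_triangle
    fun_prop
  have hi : ∀ a b : ℝ, IntervalIntegrable (fun θ : ℝ => (triangle (θ - c) : ℂ) * φ θ)
      MeasureTheory.volume a b := fun a b => hcont.intervalIntegrable a b
  have h0 : ∀ θ : ℝ, 1 ≤ |θ - c| → (triangle (θ - c) : ℂ) * φ θ = 0 := by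
    intro θ h
    have : triangle (θ - c) = 0 := max_eq_left (by linarith)
    simp [this]
  have e1 : ∫ θ in (-L)..(c - 1), (triangle (θ - c) : ℂ) * φ θ = 0 := by
    rw [← intervalIntegral.integral_zero (a := -L) (b := c - 1)]
    refine intervalIntegral.integral_congr fun θ hθ => h0 θ ?_
    rw [Set.uIcc_of_le (by linarith)] at hθ
    rw [abs_of_nonpos] <;> linarith [hθ.2]
  have e4 : ∫ θ in (c + 1)..L, (triangle (θ - c) : ℂ) * φ θ = 0 := by
    rw [← intervalIntegral.integral_zero (a := c + 1) (b := L)]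
    refine intervalIntegral.integral_congr fun θ hθ => h0 θ ?_
    rw [Set.uIcc_of_le (by linarith)] at hθ
    rw [abs_of_nonneg] <;> linarith [hθ.1]
  have e2 : ∫ θ in (c - 1)..c, (triangle (θ - c) : ℂ) * φ θ =
      ∫ θ in (0 : ℝ)..1, (θ : ℂ) * φ (θ - 1 + c) := by
    have h := intervalIntegral.integral_comp_add_right
      (fun θ : ℝ => (triangle (θ - c) : ℂ) * φ θ) (c - 1) (a := 0) (b := 1)
    rw [show (0 : ℝ) + (c - 1) = c - 1 by ring, show (1 : ℝ) + (c - 1) = c by ring] at h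
    rw [← h]
    refine intervalIntegral.integral_congr fun θ hθ => ?_
    rw [Set.uIcc_of_le zero_le_one] at hθ
    have : triangle (θ + (c - 1) - c) = θ := by
      unfold triangle
      rw [abs_of_nonpos (by linarith [hθ.2]), max_eq_right (by linarith [hθ.1])]
      ring
    simp only [this]
    congr 2
    ring
  have e3 : ∫ θ in c..(c + 1), (triangle (θ - c) : ℂ) * φ θ =
      ∫ θ in (0 : ℝ)..1, (1 - (θ : ℂ)) * φ (θ + c) := by
    have h := intervalIntegral.integral_comp_add_right
      (fun θ : ℝ => (triangle (θ - c) : ℂ) * φ θ) c (a := 0) (b := 1)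
    rw [zero_add, add_comm 1 c] at h
    rw [← h]
    refine intervalIntegral.integral_congr fun θ hθ => ?_
    rw [Set.uIcc_of_le zero_le_one] at hθ
    have : triangle (θ + c - c) = 1 - θ := by
      unfold triangle
      rw [abs_of_nonneg (by linarith [hθ.1]), max_eq_right (by linarith [hθ.2])]
      ring
    simp only [this]
    push_cast
    rfl
  rw [← intervalIntegral.integral_add_adjacent_intervals (hi (-L) (c - 1)) (hi _ L), e1,
    ← intervalIntegral.integral_add_adjacent_intervals (hi (c - 1) c) (hi _ L), e2,
    ← intervalIntegral.integral_add_adjacent_intervals (hi c (c + 1)) (hi _ L), e3, e4,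
    intervalIntegral.integral_add]
  · ring
  · exact (by fun_prop : Continuous _).intervalIntegrable _ _
  · exact (by fun_prop : Continuous _).intervalIntegrable _ _

/-- The character `θ ↦ exp(2πi n θ / 48)`. -/
noncomputable def wave (n : ℤ) (θ : ℝ) : ℂ := Complex.exp (2 * Real.pi * Complex.I * n * θ / 48)

theorem continuous_wave (n : ℤ) : Continuous (wave n) := by
  unfold wave; fun_prop

theorem wave_add (m n : ℤ) (θ : ℝ) : wave (m + n) θ = wave m θ * wave n θ := by
  unfold wave
  rw [← Complex.exp_add]
  push_cast
  congr 1
  ring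

theorem wave_arg_add (n : ℤ) (θ φ : ℝ) : wave n (θ + φ) = wave n θ * wave n φ := by
  unfold wave
  rw [← Complex.exp_add]
  push_cast
  congr 1
  ring

theorem norm_wave (n : ℤ) (θ : ℝ) : ‖wave n θ‖ = 1 := by
  unfold wave
  rw [show 2 * (Real.pi : ℂ) * Complex.I * n * θ / 48 =
    ((2 * Real.pi * n * θ / 48 : ℝ) : ℂ) * Complex.I by push_cast; ring]
  exact Complex.norm_exp_ofReal_mul_I _

theorem wave_natCast (n : ℤ) (k : ℕ) : wave n k = wave n 1 ^ k := by
  unfold wave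
  rw [← Complex.exp_nat_mul]
  congr 1
  push_cast
  ring

theorem wave_mul_one_eq_one (m : ℤ) : wave (48 * m) 1 = 1 := by
  unfold wave
  rw [← Complex.exp_int_mul_two_pi_mul_I m]
  congr 1
  push_cast
  ring

theorem wave_one_eq_one_iff (n : ℤ) : wave n 1 = 1 ↔ (48 : ℤ) ∣ n := by
  constructor
  · intro h
    unfold wave at h
    obtain ⟨m, hm⟩ := Complex.exp_eq_one_iff.1 h
    have hpi : (2 * Real.pi * Complex.I : ℂ) ≠ 0 := Complex.two_pi_I_ne_zero
    refine ⟨m, ?_⟩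
    have h2 : (2 * Real.pi * Complex.I : ℂ) * n = (2 * Real.pi * Complex.I) * (48 * m) := by
      push_cast at hm
      linear_combination 48 * hm
    exact_mod_cast mul_left_cancel₀ hpi h2
  · rintro ⟨m, rfl⟩
    exact wave_mul_one_eq_one m

theorem integral_wave_mul (m : ℤ) :
    ∫ θ in (0 : ℝ)..1, wave (48 * m) θ = if m = 0 then 1 else 0 := by
  split_ifs with h
  · subst h
    simp [wave]
  · have hne : (2 * Real.pi * Complex.I * m : ℂ) ≠ 0 :=
      mul_ne_zero Complex.two_pi_I_ne_zero (by exact_mod_cast h)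
    have := integral_exp_mul_complex (a := 0) (b := 1) hne
    have h2 : ∀ θ : ℝ, wave (48 * m) θ = Complex.exp (2 * Real.pi * Complex.I * m * θ) := by
      intro θ
      unfold wave
      congr 1
      push_cast
      ring
    simp only [h2, this]
    have h3 := Complex.exp_int_mul_two_pi_mul_I m
    rw [mul_comm] at h3
    simp [h3]

/-- The zeroth and first moments of the triangle function against a character. -/
noncomputable def triangleMoment (j : ℕ) (n : ℤ) : ℂ :=
  ∫ θ in (0 : ℝ)..1, ((1 - θ) * ((θ : ℂ) ^ j * wave n θ) +
    θ * (((θ : ℂ) - 1) ^ j * wave n (θ - 1)))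

theorem wave_sub_one (n : ℤ) (θ : ℝ) (hn : (48 : ℤ) ∣ n) : wave n (θ - 1) = wave n θ := by
  have h := wave_arg_add n (θ - 1) 1
  rw [(wave_one_eq_one_iff n).2 hn, mul_one, sub_add_cancel] at h
  exact h.symm

/-- The transform of the triangle is a squared sinc. Here its zeros at the nonzero integers appear
because the folded weights sum to 1 and leave a full period of a character. -/
theorem triangleMoment_zero_of_dvd {n : ℤ} (hn : (48 : ℤ) ∣ n) :
    triangleMoment 0 n = if n = 0 then 1 else 0 := by
  unfold triangleMoment
  simp only [wave_sub_one n _ hn, pow_zero, one_mul]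
  obtain ⟨m, rfl⟩ := hn
  have : ∀ θ : ℝ, (1 - (θ : ℂ)) * wave (48 * m) θ + θ * wave (48 * m) θ = wave (48 * m) θ :=
    fun θ => by ring
  simp only [this, integral_wave_mul]
  simp

/-- The zeros of the squared sinc are double, and its derivative at 0 vanishes by symmetry; after
folding, `(1 - θ)θ + θ(θ - 1) = 0`. -/
theorem triangleMoment_one_of_dvd {n : ℤ} (hn : (48 : ℤ) ∣ n) : triangleMoment 1 n = 0 := by
  unfold triangleMoment
  simp only [wave_sub_one n _ hn, pow_one]
  have : ∀ θ : ℝ, (1 - (θ : ℂ)) * (θ * wave n θ) + θ * ((θ - 1) * wave n θ) = 0 :=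
    fun θ => by ring
  simp only [this, intervalIntegral.integral_zero]

theorem integral_triangle_wave {L c : ℝ} (hc : |c| + 1 ≤ L) (n : ℤ) :
    ∫ θ in (-L)..L, (triangle (θ - c) : ℂ) * wave n θ = wave n c * triangleMoment 0 n := by
  rw [integral_triangle_mul hc (continuous_wave n), triangleMoment,
    ← intervalIntegral.integral_const_mul]
  refine intervalIntegral.integral_congr fun θ _ => ?_
  simp only [wave_arg_add n _ c]
  ring

theorem integral_triangle_id_mul_wave {L c : ℝ} (hc : |c| + 1 ≤ L) (n : ℤ) :
    ∫ θ in (-L)..L, (triangle (θ - c) : ℂ) * (θ * wave n θ) =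
      wave n c * (triangleMoment 1 n + c * triangleMoment 0 n) := by
  have hw := continuous_wave n
  rw [integral_triangle_mul hc (by fun_prop), triangleMoment, triangleMoment,
    ← intervalIntegral.integral_const_mul, ← intervalIntegral.integral_add,
    ← intervalIntegral.integral_const_mul]
  · refine intervalIntegral.integral_congr fun θ _ => ?_
    simp only [wave_arg_add n _ c]
    push_cast
    ring
  · exact (by fun_prop : Continuous _).intervalIntegrable _ _
  · exact (by fun_prop : Continuous _).intervalIntegrable _ _

/-- The kernel `θ ↦ θ^j exp(2πi n θ / 48)`. -/
noncomputable def waveKernel (n : ℤ) (j : ℕ) : C(ℝ, ℂ) :=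
  ⟨fun θ => (θ : ℂ) ^ j * wave n θ, by have := continuous_wave n; fun_prop⟩

/-- Multiplication of a bounded continuous function by a character. -/
noncomputable def modulate (m : ℤ) (h : ℝ →ᵇ ℂ) : ℝ →ᵇ ℂ :=
  BoundedContinuousFunction.ofNormedAddCommGroup (fun θ => h θ * wave m θ)
    (h.continuous.mul (continuous_wave m)) ‖h‖ fun θ => by
      rw [norm_mul, norm_wave, mul_one]
      exact h.norm_coe_le_norm θ

theorem norm_modulate_le (m : ℤ) (h : ℝ →ᵇ ℂ) : ‖modulate m h‖ ≤ ‖h‖ :=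
  BoundedContinuousFunction.norm_ofNormedAddCommGroup_le _ (norm_nonneg _) _

theorem kernelPairing_modulate (L : ℝ) (n m : ℤ) (j : ℕ) (h : ℝ →ᵇ ℂ) :
    kernelPairing L (waveKernel n j) (modulate m h) = kernelPairing L (waveKernel (n + m) j) h := by
  simp only [kernelPairing_apply]
  refine intervalIntegral.integral_congr fun θ _ => ?_
  change h θ * wave m θ * ((θ : ℂ) ^ j * wave n θ) = h θ * ((θ : ℂ) ^ j * wave (n + m) θ)
  rw [wave_add]
  ring

/-- The combination of fifty integer translates of the triangle function with the
coefficients of a polynomial. -/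
noncomputable def triangleComb (p : Polynomial ℂ) : ℝ →ᵇ ℂ :=
  BoundedContinuousFunction.ofNormedAddCommGroup
    (fun θ => ∑ k ∈ Finset.range 50, p.coeff k * (triangle (θ - (k - 25 : ℝ)) : ℂ))
    (by have := continuous_triangle; fun_prop) (∑ k ∈ Finset.range 50, ‖p.coeff k‖) fun θ => by
      refine norm_sum_le_of_le _ fun k _ => ?_
      rw [norm_mul, Complex.norm_real, Real.norm_eq_abs]
      exact mul_le_of_le_one_right (norm_nonneg _) (abs_triangle_le_one _)

theorem abs_center_add_one_le {k : ℕ} (hk : k ∈ Finset.range 50) :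
    |(k : ℝ) - 25| + 1 ≤ 26 := by
  have h : (k : ℝ) ≤ 49 := by
    have := Finset.mem_range.1 hk
    exact_mod_cast (by omega : k ≤ 49)
  have h0 : (0 : ℝ) ≤ k := Nat.cast_nonneg k
  have : |(k : ℝ) - 25| ≤ 25 := abs_le.2 ⟨by linarith, by linarith⟩
  linarith

theorem wave_natCast_sub (n : ℤ) (k : ℕ) :
    wave n ((k : ℝ) - 25) = wave n (-25) * wave n 1 ^ k := by
  rw [sub_eq_add_neg, wave_arg_add, wave_natCast, mul_comm]

theorem kernelPairing_triangleComb_aux (p : Polynomial ℂ) (n : ℤ) (j : ℕ) :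
    kernelPairing 26 (waveKernel n j) (triangleComb p) =
      ∑ k ∈ Finset.range 50, p.coeff k *
        ∫ θ in (-26 : ℝ)..26, (triangle (θ - (k - 25 : ℝ)) : ℂ) * ((θ : ℂ) ^ j * wave n θ) := by
  simp only [← intervalIntegral.integral_const_mul]
  rw [← intervalIntegral.integral_finsetSum]
  · refine intervalIntegral.integral_congr fun θ _ => ?_
    change (∑ k ∈ Finset.range 50, p.coeff k * (triangle (θ - (k - 25 : ℝ)) : ℂ)) *
      ((θ : ℂ) ^ j * wave n θ) = _
    rw [Finset.sum_mul]
    exact Finset.sum_congr rfl fun k _ => by ring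
  · intro k _
    have := continuous_triangle
    have := continuous_wave n
    exact (by fun_prop : Continuous _).intervalIntegrable _ _

theorem kernelPairing_zero_triangleComb {p : Polynomial ℂ} (hp : p.natDegree < 50) (n : ℤ) :
    kernelPairing 26 (waveKernel n 0) (triangleComb p) =
      wave n (-25) * p.eval (wave n 1) * triangleMoment 0 n := by
  rw [kernelPairing_triangleComb_aux, Polynomial.eval_eq_sum_range' hp, Finset.mul_sum,
    Finset.sum_mul]
  refine Finset.sum_congr rfl fun k hk => ?_
  simp only [pow_zero, one_mul]
  rw [integral_triangle_wave (abs_center_add_one_le hk), wave_natCast_sub]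
  ring

/-- The moment of the translate centred at `k - 25` brings down a factor `k - 25`: the operator `z
d/dz` on `p` accounts for `k`, and the recentring gives the term `-25 p`. -/
theorem kernelPairing_one_triangleComb {p : Polynomial ℂ} (hp : p.natDegree < 50) (n : ℤ) :
    kernelPairing 26 (waveKernel n 1) (triangleComb p) =
      wave n (-25) * (p.eval (wave n 1) * triangleMoment 1 n +
        (wave n 1 * p.derivative.eval (wave n 1) - 25 * p.eval (wave n 1)) *
          triangleMoment 0 n) := by
  have hd : wave n 1 * p.derivative.eval (wave n 1) =
      ∑ k ∈ Finset.range 50, p.coeff k * k * wave n 1 ^ k := by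
    rw [Polynomial.derivative_eval, Polynomial.sum_over_range' _ _ 50 hp, Finset.mul_sum]
    · refine Finset.sum_congr rfl fun k _ => ?_
      rcases k with _ | k
      · simp
      · rw [Nat.add_sub_cancel, pow_succ]; ring
    · simp
  rw [kernelPairing_triangleComb_aux, hd, Polynomial.eval_eq_sum_range' hp, Finset.mul_sum,
    Finset.sum_mul, ← Finset.sum_sub_distrib, Finset.sum_mul, ← Finset.sum_add_distrib,
    Finset.mul_sum]
  refine Finset.sum_congr rfl fun k hk => ?_
  simp only [pow_one]
  rw [integral_triangle_id_mul_wave (abs_center_add_one_le hk), wave_natCast_sub]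
  push_cast
  ring

/-! ### The biorthogonal system at the nodes. -/

/-- Residues modulo 48: those of numbers incongruent to `2` modulo `3` and modulo `4`, and the
extra residue `2`. -/
noncomputable def nodeResidues : Finset ℤ :=
  (Finset.Ico (0 : ℤ) 48).filter fun n => (n % 3 ≠ 2 ∧ n % 4 ≠ 2) ∨ n = 2

theorem card_nodeResidues : nodeResidues.card = 25 := by decide

theorem wave_neg_natCast_of_dvd {n : ℤ} (hn : (48 : ℤ) ∣ n) (k : ℕ) : wave n (-(k : ℝ)) = 1 := by
  have h := wave_arg_add n (-(k : ℝ)) k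
  rw [wave_natCast, (wave_one_eq_one_iff n).2 hn, one_pow, mul_one, neg_add_cancel] at h
  rw [← h]
  simp [wave]

/-- Other residues are killed by double zeros of the polynomial at the corresponding roots of unity;
other integers in the class of `a` are killed by the double zeros of the transform of the triangle.
Double zeros at 24 points and two data at 1 need degree at most 49, hence fifty translates. -/
theorem exists_biorthogonal_residue {a : ℤ} (ha : a ∈ nodeResidues) (j : Fin 2) :
    ∃ h : ℝ →ᵇ ℂ, ∀ n : ℤ, n % 48 ∈ nodeResidues → ∀ i : Fin 2,
      kernelPairing 26 (waveKernel n i) h = if n = a ∧ i = j then 1 else 0 := by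
  classical
  have hmem : ∀ b ∈ nodeResidues, 0 ≤ b ∧ b < 48 := fun b hb =>
    Finset.mem_Ico.1 (Finset.mem_filter.1 hb).1
  let S : Finset ℂ := (nodeResidues.erase a).image fun b => wave (b - a) 1
  have hS1 : (1 : ℂ) ∉ S := by
    intro h
    obtain ⟨b, hb, hb1⟩ := Finset.mem_image.1 h
    obtain ⟨hba, hb⟩ := Finset.mem_erase.1 hb
    have h1 := (wave_one_eq_one_iff _).1 hb1
    have h2 := hmem a ha
    have h3 := hmem b hb
    omega
  have hScard : S.card ≤ 24 := by
    refine Finset.card_image_le.trans ?_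
    rw [Finset.card_erase_of_mem ha, card_nodeResidues]
  -- The summand 25 in the prescribed derivative cancels the `-25 p` term caused by the centring of
  -- the translates.
  obtain ⟨p, hdeg, hp, hp', hpS⟩ := exists_polynomial_double_zeros S hS1
    (if j = 0 then 1 else 0) ((if j = 1 then 1 else 0) + 25 * if j = 0 then 1 else 0)
  have hdeg' : p.natDegree < 50 := by omega
  refine ⟨modulate (-a) (triangleComb p), fun n hn i => ?_⟩
  rw [kernelPairing_modulate, ← sub_eq_add_neg]
  by_cases hna : n % 48 = a
  · have hdvd : (48 : ℤ) ∣ n - a := by omega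
    have hw : wave (n - a) 1 = 1 := (wave_one_eq_one_iff _).2 hdvd
    have hw25 : wave (n - a) (-25) = 1 := by
      simpa using wave_neg_natCast_of_dvd hdvd 25
    fin_cases i
    · change kernelPairing 26 (waveKernel (n - a) 0) (triangleComb p) = _
      rw [kernelPairing_zero_triangleComb hdeg', hw, hw25, hp, triangleMoment_zero_of_dvd hdvd]
      simp only [sub_eq_zero]
      by_cases h : n = a <;> fin_cases j <;> simp [h]
    · change kernelPairing 26 (waveKernel (n - a) 1) (triangleComb p) = _
      rw [kernelPairing_one_triangleComb hdeg', hw, hw25, hp, hp',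
        triangleMoment_zero_of_dvd hdvd, triangleMoment_one_of_dvd hdvd]
      simp only [sub_eq_zero]
      by_cases h : n = a <;> fin_cases j <;> simp [h]
  · have hw : wave (n - a) 1 = wave (n % 48 - a) 1 := by
      rw [show n - a = (n % 48 - a) + 48 * (n / 48) by omega, wave_add, wave_mul_one_eq_one,
        mul_one]
    have hwS : wave (n - a) 1 ∈ S := by
      rw [hw]
      exact Finset.mem_image_of_mem (fun b => wave (b - a) 1) (Finset.mem_erase.2 ⟨hna, hn⟩)
    obtain ⟨h0, h1⟩ := hpS _ hwS
    have hne : n ≠ a := by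
      rintro rfl
      have := hmem n ha
      omega
    rw [if_neg fun h => hne h.1]
    fin_cases i
    · change kernelPairing 26 (waveKernel (n - a) 0) (triangleComb p) = _
      rw [kernelPairing_zero_triangleComb hdeg', h0]
      simp
    · change kernelPairing 26 (waveKernel (n - a) 1) (triangleComb p) = _
      rw [kernelPairing_one_triangleComb hdeg', h0, h1]
      simp

/-- A bounded system biorthogonal to the wave functionals at the nodes. -/
theorem exists_bounded_biorthogonal :
    ∃ (C : ℝ) (e : ℤ → Fin 2 → (ℝ →ᵇ ℂ)),
      (∀ n, n % 48 ∈ nodeResidues → ∀ j, ‖e n j‖ ≤ C) ∧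
      ∀ m n, m % 48 ∈ nodeResidues → n % 48 ∈ nodeResidues → ∀ i j : Fin 2,
        kernelPairing 26 (waveKernel m i) (e n j) = if m = n ∧ i = j then 1 else 0 := by
  classical
  choose h hh using fun (a : nodeResidues) (j : Fin 2) => exists_biorthogonal_residue a.2 j
  let h' : ℤ → Fin 2 → (ℝ →ᵇ ℂ) := fun a j => if ha : a ∈ nodeResidues then h ⟨a, ha⟩ j else 0
  have hh' : ∀ a, ∀ ha : a ∈ nodeResidues, ∀ j, h' a j = h ⟨a, ha⟩ j := fun a ha j => dif_pos ha
  -- Modulation by a multiple of 48 moves the function built for a residue to any node of its class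
  -- without increasing the norm, so finitely many functions give a uniform bound.
  refine ⟨∑ a ∈ nodeResidues, ∑ j, ‖h' a j‖,
    fun n j => modulate (-(n - n % 48)) (h' (n % 48) j), fun n hn j => ?_,
    fun m n hm hn i j => ?_⟩
  · refine (norm_modulate_le _ _).trans ?_
    refine le_trans ?_ (Finset.single_le_sum (f := fun a => ∑ j, ‖h' a j‖)
      (fun a _ => Finset.sum_nonneg fun j _ => norm_nonneg _) hn)
    exact Finset.single_le_sum (f := fun j => ‖h' (n % 48) j‖) (fun j _ => norm_nonneg _)
      (Finset.mem_univ j)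
  · rw [kernelPairing_modulate, hh' _ hn, hh ⟨n % 48, hn⟩ j]
    · have : m + -(n - n % 48) = n % 48 ↔ m = n := by omega
      simp only [this]
    · rw [show (m + -(n - n % 48)) % 48 = m % 48 by omega]
      exact hm

/-! ### The Gaussian rates, their duals, and the decay gap. -/

/-- The complex exponents of the Gaussians that are superposed. -/
noncomputable def rate (θ : ℝ) : ℂ := Real.pi * (1 / 10 - Complex.I * Real.sqrt 3 * θ / 48)

theorem continuous_rate : Continuous rate := by unfold rate; fun_prop

theorem rate_re (θ : ℝ) : (rate θ).re = Real.pi / 10 := by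
  have : rate θ = ((Real.pi / 10 : ℝ) : ℂ) +
      ((-(Real.pi * Real.sqrt 3 * θ / 48) : ℝ) : ℂ) * Complex.I := by
    unfold rate; push_cast; ring
  rw [this]
  simp

theorem rate_im (θ : ℝ) : (rate θ).im = -(Real.pi * Real.sqrt 3 * θ / 48) := by
  have : rate θ = ((Real.pi / 10 : ℝ) : ℂ) +
      ((-(Real.pi * Real.sqrt 3 * θ / 48) : ℝ) : ℂ) * Complex.I := by
    unfold rate; push_cast; ring
  rw [this]
  simp

theorem rate_ne_zero (θ : ℝ) : rate θ ≠ 0 := by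
  intro h
  have := congrArg Complex.re h
  rw [rate_re, Complex.zero_re] at this
  have := Real.pi_pos
  linarith

/-- The exponents of the Fourier transforms of the Gaussians. -/
noncomputable def dualRate (θ : ℝ) : ℂ := (Real.pi : ℂ) ^ 2 / rate θ

theorem continuous_dualRate : Continuous dualRate :=
  continuous_const.div continuous_rate rate_ne_zero

/-- The Fourier transforms of the Gaussians decay strictly faster than the Gaussians. -/
theorem le_dualRate_re {θ : ℝ} (hθ : |θ| ≤ 26) :
    Real.pi / 10 + Real.pi / 100 ≤ (dualRate θ).re := by
  have hpi := Real.pi_pos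
  have hθ2 : θ ^ 2 ≤ 676 := by
    have := sq_le_sq' (abs_le.1 hθ).1 (abs_le.1 hθ).2
    linarith
  have h3 : Real.sqrt 3 ^ 2 = 3 := Real.sq_sqrt (by norm_num)
  have hns : Complex.normSq (rate θ) = Real.pi ^ 2 * (1 / 100 + 3 * θ ^ 2 / 2304) := by
    rw [Complex.normSq_apply, rate_re, rate_im]
    linear_combination (Real.pi ^ 2 * θ ^ 2 / 2304) * h3
  have hre : (dualRate θ).re = Real.pi / 10 / (1 / 100 + 3 * θ ^ 2 / 2304) := by
    unfold dualRate
    rw [← Complex.ofReal_pow, Complex.div_re, hns, rate_re]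
    simp only [Complex.ofReal_re, Complex.ofReal_im, zero_mul, zero_div, add_zero]
    field_simp
  -- The denominator is at most 1/100 + 3·676/2304 < 0.891, and 0.11·0.891 < 0.1.
  rw [hre, le_div_iff₀ (by positivity)]
  nlinarith

/-- The parameter `u = |x|²` at the `n`-th node. -/
noncomputable def nodeParam (n : ℕ) : ℝ := 2 * n / Real.sqrt 3

theorem nodeParam_nonneg (n : ℕ) : 0 ≤ nodeParam n := by unfold nodeParam; positivity

theorem exp_neg_rate_mul_nodeParam (θ : ℝ) (n : ℕ) :
    Complex.exp (-rate θ * nodeParam n) =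
      Complex.exp (-(Real.pi / 10) * nodeParam n) * wave n θ := by
  unfold wave
  rw [← Complex.exp_add]
  congr 1
  have h3 : (Real.sqrt 3 : ℂ) ≠ 0 := by
    exact_mod_cast (Real.sqrt_pos.2 (by norm_num : (0 : ℝ) < 3)).ne'
  unfold rate nodeParam
  push_cast
  field_simp
  ring

/-- The factor turning a derivative into a moment. -/
noncomputable def momentFactor : ℂ := Complex.I * Real.pi * Real.sqrt 3 / 48

theorem momentFactor_ne_zero : momentFactor ≠ 0 := by
  have h3 : (Real.sqrt 3 : ℂ) ≠ 0 := by
    exact_mod_cast (Real.sqrt_pos.2 (by norm_num : (0 : ℝ) < 3)).ne'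
  have hpi : (Real.pi : ℂ) ≠ 0 := by exact_mod_cast Real.pi_ne_zero
  unfold momentFactor
  simp [h3, hpi, Complex.I_ne_zero]

theorem rate_eq (θ : ℝ) : rate θ = Real.pi / 10 - momentFactor * θ := by
  unfold rate momentFactor; ring

/-- The amplitude of the kernels of the perturbing functionals. -/
noncomputable def dualAmplitude (j : ℕ) (θ : ℝ) : ℂ :=
  Real.pi / rate θ * ((Real.pi / 10 - dualRate θ) / momentFactor) ^ j

theorem continuous_dualAmplitude (j : ℕ) : Continuous (dualAmplitude j) := by
  have h1 := continuous_dualRate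
  have h2 : Continuous fun θ => (Real.pi : ℂ) / rate θ :=
    continuous_const.div continuous_rate rate_ne_zero
  unfold dualAmplitude
  fun_prop

/-- The kernels of the functionals giving the normalized data of the Fourier transform. -/
noncomputable def dualKernel (n j : ℕ) : C(ℝ, ℂ) :=
  ⟨fun θ => dualAmplitude j θ * Complex.exp ((Real.pi / 10 - dualRate θ) * nodeParam n), by
    have h1 := continuous_dualRate
    have h2 := continuous_dualAmplitude j
    fun_prop⟩

/-- After division by `exp(-π u/10)`, the gap of `π/100` in `le_dualRate_re` remains as exponential
decay in `u`, and `u` is proportional to `n` at the nodes. -/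
theorem exists_norm_dualKernel_le :
    ∃ C r : ℝ, 0 ≤ C ∧ 0 ≤ r ∧ r < 1 ∧ ∀ (n : ℕ) (j : Fin 2),
      ‖kernelPairing 26 (dualKernel n j)‖ ≤ C * r ^ n := by
  choose C hC0 hC using fun j : Fin 2 => exists_norm_le_on_uIoc 26 (continuous_dualAmplitude j)
  have hs3 : 0 < Real.sqrt 3 := Real.sqrt_pos.2 (by norm_num)
  have hpi := Real.pi_pos
  refine ⟨(C 0 + C 1) * |(26 : ℝ) - -26|, Real.exp (-(Real.pi / 100) * (2 / Real.sqrt 3)),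
    mul_nonneg (add_nonneg (hC0 0) (hC0 1)) (abs_nonneg _), (Real.exp_pos _).le, ?_,
    fun n j => ?_⟩
  · rw [Real.exp_lt_one_iff]
    have : 0 < Real.pi / 100 * (2 / Real.sqrt 3) := by positivity
    linarith
  · have hCj : C j ≤ C 0 + C 1 := by
      have := hC0 0
      have := hC0 1
      fin_cases j <;> simp <;> linarith
    have hexp : Real.exp (-(Real.pi / 100) * (2 / Real.sqrt 3)) ^ n =
        Real.exp (-(Real.pi / 100) * nodeParam n) := by
      rw [← Real.exp_nat_mul]
      congr 1
      unfold nodeParam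
      ring
    rw [hexp, mul_right_comm]
    refine norm_kernelPairing_le _ _ (mul_nonneg (add_nonneg (hC0 0) (hC0 1)) (Real.exp_pos _).le)
      fun θ hθ => ?_
    change ‖dualAmplitude j θ * Complex.exp ((Real.pi / 10 - dualRate θ) * nodeParam n)‖ ≤ _
    rw [norm_mul, Complex.norm_exp]
    have hθ' : |θ| ≤ 26 := by
      rw [Set.uIoc_of_le (by norm_num)] at hθ
      exact abs_le.2 ⟨hθ.1.le, hθ.2⟩
    refine mul_le_mul ((hC j θ hθ).trans hCj) (Real.exp_le_exp.2 ?_) (Real.exp_pos _).le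
      (add_nonneg (hC0 0) (hC0 1))
    have hre : (((Real.pi : ℂ) / 10 - dualRate θ) * nodeParam n).re =
        (Real.pi / 10 - (dualRate θ).re) * nodeParam n := by
      rw [Complex.re_mul_ofReal, Complex.sub_re]
      norm_num [Complex.div_re]
    rw [hre]
    refine mul_le_mul_of_nonneg_right ?_ (nodeParam_nonneg n)
    linarith [le_dualRate_re hθ']

/-! ### Self-dual functions and their data at the nodes. -/

/-- The profile of the self-dual superposition of Gaussians with density `h`. -/
noncomputable def selfDualProfile (h : ℝ →ᵇ ℂ) (u : ℝ) : ℂ :=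
  laplaceInt 26 rate h u + laplaceInt 26 dualRate (fun θ => h θ * (Real.pi / rate θ)) u

theorem selfDualProfile_nodeParam (h : ℝ →ᵇ ℂ) (n : ℕ) :
    selfDualProfile h (nodeParam n) =
      Complex.exp (-(Real.pi / 10) * nodeParam n) *
        (kernelPairing 26 (waveKernel n 0) h + kernelPairing 26 (dualKernel n 0) h) := by
  unfold selfDualProfile laplaceInt
  rw [kernelPairing_apply, kernelPairing_apply, mul_add, ← intervalIntegral.integral_const_mul,
    ← intervalIntegral.integral_const_mul]
  congr 1
  · refine intervalIntegral.integral_congr fun θ _ => ?_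
    change _ = _ * (h θ * ((θ : ℂ) ^ 0 * wave n θ))
    simp only [exp_neg_rate_mul_nodeParam]
    ring
  · refine intervalIntegral.integral_congr fun θ _ => ?_
    change _ = _ * (h θ * (Real.pi / rate θ * _ ^ 0 *
      Complex.exp ((Real.pi / 10 - dualRate θ) * nodeParam n)))
    have : Complex.exp (-dualRate θ * nodeParam n) = Complex.exp (-(Real.pi / 10) * nodeParam n) *
        Complex.exp ((Real.pi / 10 - dualRate θ) * nodeParam n) := by
      rw [← Complex.exp_add]; congr 1; ring
    simp only [this]
    ring

theorem continuous_mul_pi_div_rate (h : ℝ →ᵇ ℂ) :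
    Continuous fun θ => h θ * ((Real.pi : ℂ) / rate θ) :=
  h.continuous.mul (continuous_const.div continuous_rate rate_ne_zero)

/-- Differentiation brings down `-rate θ = momentFactor * θ - π/10`, and `dualAmplitude` is
normalized so that `-dualRate θ` splits in the same way. The constant part reproduces the profile,
so at a zero of the profile only the first moments matter. -/
theorem hasDerivAt_selfDualProfile_nodeParam (h : ℝ →ᵇ ℂ) (n : ℕ) :
    HasDerivAt (selfDualProfile h)
      (Complex.exp (-(Real.pi / 10) * nodeParam n) * momentFactor *
        (kernelPairing 26 (waveKernel n 1) h + kernelPairing 26 (dualKernel n 1) h) -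
        Real.pi / 10 * selfDualProfile h (nodeParam n)) (nodeParam n) := by
  have hc := continuous_mul_pi_div_rate h
  have hr := continuous_rate
  have hd := continuous_dualRate
  have hh := h.continuous
  refine ((hasDerivAt_laplaceInt 26 hr hh (nodeParam n)).add
    (hasDerivAt_laplaceInt 26 hd hc (nodeParam n))).congr_deriv ?_
  unfold selfDualProfile laplaceInt
  rw [kernelPairing_apply, kernelPairing_apply, mul_add, mul_add,
    ← intervalIntegral.integral_const_mul, ← intervalIntegral.integral_const_mul,
    ← intervalIntegral.integral_const_mul, ← intervalIntegral.integral_const_mul,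
    add_sub_add_comm, ← intervalIntegral.integral_sub, ← intervalIntegral.integral_sub]
  · congr 1
    · refine intervalIntegral.integral_congr fun θ _ => ?_
      change _ = _ * (h θ * ((θ : ℂ) ^ 1 * wave n θ)) - _
      simp only [exp_neg_rate_mul_nodeParam]
      rw [rate_eq]
      ring
    · refine intervalIntegral.integral_congr fun θ _ => ?_
      change _ = _ * (h θ * (Real.pi / rate θ * ((Real.pi / 10 - dualRate θ) / momentFactor) ^ 1 *
        Complex.exp ((Real.pi / 10 - dualRate θ) * nodeParam n))) - _
      have : Complex.exp (-dualRate θ * nodeParam n) =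
          Complex.exp (-(Real.pi / 10) * nodeParam n) *
          Complex.exp ((Real.pi / 10 - dualRate θ) * nodeParam n) := by
        rw [← Complex.exp_add]; congr 1; ring
      simp only [this]
      have hm := momentFactor_ne_zero
      have hρ := rate_ne_zero θ
      field_simp
      ring
  · exact (continuous_const.mul (hh.mul (dualKernel n 1).continuous)).intervalIntegrable _ _
  · exact (by fun_prop : Continuous _).intervalIntegrable _ _
  · exact (continuous_const.mul (hh.mul (waveKernel n 1).continuous)).intervalIntegrable _ _
  · exact (by fun_prop : Continuous _).intervalIntegrable _ _

/-- Every density gives a radial Schwartz function equal to its own Fourier transform. -/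
theorem exists_selfDual_schwartzMap (h : ℝ →ᵇ ℂ) :
    ∃ f : 𝓢(Plane, ℂ), 𝓕 f = f ∧ ∀ x, f x = selfDualProfile h (‖x‖ ^ 2) := by
  have hpi := Real.pi_pos
  obtain ⟨g, hg⟩ := exists_schwartzMap_laplaceInt (E := Plane) 26 continuous_rate h.continuous
    (σ := Real.pi / 10) (by positivity) fun θ _ => (rate_re θ).ge
  have hFg : ∀ ξ, 𝓕 g ξ =
      laplaceInt 26 dualRate (fun θ => h θ * (Real.pi / rate θ)) (‖ξ‖ ^ 2) := by
    intro ξ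
    rw [SchwartzMap.fourier_coe, show (g : Plane → ℂ) = _ from funext hg]
    exact fourier_laplaceInt 26 (by norm_num) continuous_rate h.continuous
      (σ := Real.pi / 10) (by positivity) (fun θ => (rate_re θ).ge) ξ
  -- Since `g` is even, applying `𝓕` twice gives `g` back, and `𝓕` swaps the two summands.
  refine ⟨g + 𝓕 g, ?_, fun x => ?_⟩
  · have hFF : 𝓕 (𝓕 g) = g := by
      ext x
      have h1 : 𝓕⁻ (𝓕 g) (-x) = g (-x) := by rw [FourierTransform.fourierInv_fourier_eq]
      rw [SchwartzMap.fourierInv_coe, Real.fourierInv_eq_fourier_neg, neg_neg] at h1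
      rw [SchwartzMap.fourier_coe, h1, hg, hg, norm_neg]
    rw [FourierTransform.fourier_add, hFF, add_comm]
  · rw [add_apply, hg, hFg]
    rfl

/-! ### Solving the conditions at the hexagonal radii. -/

/-- The index set of the node conditions: a node and the order of the derivative. -/
abbrev NodeIndex : Type := {n : ℕ // (n : ℤ) % 48 ∈ nodeResidues} × Fin 2

/-- The nodes in the extra residue class, where only the value is left free. -/
def extraIndices : Set NodeIndex := {i | (i.1 : ℕ) % 48 = 2 ∧ i.2 = 0}

theorem extraIndices_infinite : extraIndices.Infinite := by
  have h2 : ∀ k : ℕ, ((48 * k + 2 : ℕ) : ℤ) % 48 ∈ nodeResidues := fun k => by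
    rw [show ((48 * k + 2 : ℕ) : ℤ) % 48 = 2 by omega]
    decide
  refine Set.infinite_of_injective_forall_mem
    (f := fun k : ℕ => ((⟨48 * k + 2, h2 k⟩, 0) : NodeIndex)) (fun k l hkl => ?_) fun k => ?_
  · have h := congrArg (fun i : NodeIndex => (i.1 : ℕ)) hkl
    simp only at h
    omega
  · exact ⟨by simp only; omega, rfl⟩

/-- The biorthogonal functions are bounded and the perturbing functionals decay geometrically, so
the products of norms are summable. -/
theorem exists_densities :
    ∃ x : ℕ → (ℝ →ᵇ ℂ),
      LinearIndependent ℂ (fun k (i : extraIndices) =>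
        kernelPairing 26 (waveKernel (i.1.1 : ℕ) i.1.2) (x k) +
          kernelPairing 26 (dualKernel i.1.1 i.1.2) (x k)) ∧
      ∀ k, ∀ i ∉ extraIndices,
        kernelPairing 26 (waveKernel (i.1 : ℕ) i.2) (x k) +
          kernelPairing 26 (dualKernel i.1 i.2) (x k) = 0 := by
  obtain ⟨B, e, heB, he⟩ := exists_bounded_biorthogonal
  obtain ⟨C, r, hC, hr0, hr1, hS⟩ := exists_norm_dualKernel_le
  refine exists_linearIndependent_data
    (fun i : NodeIndex => kernelPairing 26 (waveKernel (i.1 : ℕ) i.2))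
    (fun i => kernelPairing 26 (dualKernel i.1 i.2)) (fun i => e (i.1 : ℕ) i.2)
    (fun i => ?_) (fun i j hij => ?_) ?_ extraIndices extraIndices_infinite
  · rw [he _ _ i.1.2 i.1.2]
    simp
  · rw [he _ _ i.1.2 j.1.2, if_neg]
    rintro ⟨h1, h2⟩
    exact hij (Prod.ext (Subtype.ext (by exact_mod_cast h1)) h2)
  · have h1 : Summable fun p : ℕ × Fin 2 => C * r ^ p.1 * B := by
      have := (summable_geometric_of_lt_one hr0 hr1).mul_of_nonneg
        (Summable.of_finite (f := fun _ : Fin 2 => (1 : ℝ)))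
        (fun n => pow_nonneg hr0 n) (fun _ => zero_le_one)
      refine ((this.mul_left C).mul_right B).congr fun p => ?_
      simp
    have hinj : Function.Injective fun i : NodeIndex => (((i.1 : ℕ), i.2) : ℕ × Fin 2) := by
      rintro ⟨m, i⟩ ⟨n, j⟩ h
      simp only [Prod.mk.injEq] at h
      exact Prod.ext (Subtype.ext h.1) h.2
    refine Summable.of_nonneg_of_le (fun i => by positivity) (fun i => ?_)
      (h1.comp_injective hinj)
    exact mul_le_mul (hS i.1 i.2) (heB _ i.1.2 i.2) (norm_nonneg _)
      (mul_nonneg hC (pow_nonneg hr0 _))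

/-- Self-dual radial functions that vanish to order two at the hexagonal radii. -/
def IsHexSolution (f : 𝓢(Plane, ℂ)) : Prop :=
  𝓕 f = f ∧ IsRadial f ∧ ∀ r ∈ hexRadii, VanishesToOrderTwoAt f r

/-- The two congruence obstructions of the form `x² + xy + y²` place every required node among the
24 genuine residues; the class of 2 modulo 48 never occurs, which is why it can be left free. -/
theorem exists_node_of_mem_hexRadii {r : ℝ} (hr : r ∈ hexRadii) :
    ∃ n : ℕ, r ^ 2 = nodeParam n ∧ (n : ℤ) % 48 ∈ nodeResidues ∧ n % 48 ≠ 2 := by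
  obtain ⟨x, y, rfl⟩ := hr
  have hnn : 0 ≤ x ^ 2 + x * y + y ^ 2 := by nlinarith [sq_nonneg (x + y), sq_nonneg x, sq_nonneg y]
  obtain ⟨n, hn⟩ := Int.eq_ofNat_of_zero_le hnn
  have h3 : (x ^ 2 + x * y + y ^ 2) % 3 ≠ 2 := by
    rcases (by omega : x % 3 = 0 ∨ x % 3 = 1 ∨ x % 3 = 2) with hx | hx | hx <;>
    rcases (by omega : y % 3 = 0 ∨ y % 3 = 1 ∨ y % 3 = 2) with hy | hy | hy <;>
    simp [pow_two, Int.add_emod, Int.mul_emod, hx, hy]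
  have h4 : (x ^ 2 + x * y + y ^ 2) % 4 ≠ 2 := by
    rcases (by omega : x % 4 = 0 ∨ x % 4 = 1 ∨ x % 4 = 2 ∨ x % 4 = 3) with hx | hx | hx | hx <;>
    rcases (by omega : y % 4 = 0 ∨ y % 4 = 1 ∨ y % 4 = 2 ∨ y % 4 = 3) with hy | hy | hy | hy <;>
    simp [pow_two, Int.add_emod, Int.mul_emod, hx, hy]
  rw [hn] at h3 h4
  refine ⟨n, ?_, ?_, by omega⟩
  · rw [hn, Real.sq_sqrt]
    · rfl
    · exact nodeParam_nonneg n
  · refine Finset.mem_filter.2 ⟨Finset.mem_Ico.2 ⟨by omega, by omega⟩, Or.inl ⟨by omega, by omega⟩⟩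

theorem isHexSolution_of_data {h : ℝ →ᵇ ℂ}
    (hh : ∀ i : NodeIndex, i ∉ extraIndices →
      kernelPairing 26 (waveKernel (i.1 : ℕ) i.2) h +
        kernelPairing 26 (dualKernel i.1 i.2) h = 0)
    {f : 𝓢(Plane, ℂ)} (hF : 𝓕 f = f) (hf : ∀ x, f x = selfDualProfile h (‖x‖ ^ 2)) :
    IsHexSolution f := by
  refine ⟨hF, fun x y hxy => by rw [hf, hf, hxy], fun r hr => ?_⟩
  obtain ⟨n, hrn, hn, hn2⟩ := exists_node_of_mem_hexRadii hr
  have hprof : ∀ u, 0 ≤ u → profile f u = selfDualProfile h u := fun u hu => by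
    rw [profile, hf]
    simp [Real.sq_sqrt hu]
  have h0 := hh (⟨n, hn⟩, 0) fun h => hn2 h.1
  have h1 := hh (⟨n, hn⟩, 1) fun h => hn2 h.1
  have hz : selfDualProfile h (nodeParam n) = 0 := by
    rw [selfDualProfile_nodeParam]
    exact mul_eq_zero_of_right _ h0
  have hd := hasDerivAt_selfDualProfile_nodeParam h n
  rw [hz, mul_zero, sub_zero] at hd
  have hd0 : HasDerivAt (selfDualProfile h) 0 (nodeParam n) :=
    hd.congr_deriv (mul_eq_zero_of_right _ h1)
  rw [VanishesToOrderTwoAt, hrn]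
  refine ⟨by rw [hprof _ (nodeParam_nonneg n), hz], ?_⟩
  -- The two profiles are only known to agree for `u ≥ 0`, which suffices for the derivative within
  -- that half-line, including at `u = 0`.
  exact hd0.hasDerivWithinAt.congr (fun u hu => hprof u hu) (hprof _ (nodeParam_nonneg n))

theorem exists_linearIndependent_isHexSolution :
    ∃ f : ℕ → 𝓢(Plane, ℂ), LinearIndependent ℂ f ∧ ∀ k, IsHexSolution (f k) := by
  obtain ⟨x, hli, hx⟩ := exists_densities
  choose f hF hf using fun k => exists_selfDual_schwartzMap (x k)
  refine ⟨f, ?_, fun k => isHexSolution_of_data (hx k) (hF k) (hf k)⟩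
  let pt : extraIndices → Plane := fun i =>
    EuclideanSpace.single 0 (Real.sqrt (nodeParam i.1.1))
  let Ψ : 𝓢(Plane, ℂ) →ₗ[ℂ] (extraIndices → ℂ) :=
    -- Sampling at the extra nodes, with the Gaussian factor removed, recovers exactly the
    -- independent data vectors of the densities.
    { toFun := fun g i => Complex.exp (Real.pi / 10 * nodeParam i.1.1) * g (pt i)
      map_add' := fun g g' => by ext i; simp [mul_add]
      map_smul' := fun c g => by ext i; simp; ring }
  refine LinearIndependent.of_comp Ψ ?_
  convert hli using 1
  funext k i
  change Complex.exp (Real.pi / 10 * nodeParam i.1.1) * f k (pt i) = _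
  have hpt : ‖pt i‖ ^ 2 = nodeParam i.1.1 := by
    simp [pt, Real.sq_sqrt (nodeParam_nonneg _)]
  rw [hf, hpt, selfDualProfile_nodeParam, ← mul_assoc, ← Complex.exp_add, i.2.2,
    show (Real.pi : ℂ) / 10 * nodeParam i.1.1 + -(Real.pi / 10) * nodeParam i.1.1 = 0 by ring,
    Complex.exp_zero, one_mul]
  rfl

/-! ### Passage to real-valued functions. -/

/-- The complex conjugate of a Schwartz function. -/
noncomputable def conjSchwartz (f : 𝓢(Plane, ℂ)) : 𝓢(Plane, ℂ) :=
  SchwartzMap.postcompCLM (𝕜 := ℝ) (Complex.conjCLE : ℂ →L[ℝ] ℂ) f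

theorem conjSchwartz_apply (f : 𝓢(Plane, ℂ)) (x : Plane) :
    conjSchwartz f x = (starRingEnd ℂ) (f x) := rfl

theorem fourier_conjSchwartz (f : 𝓢(Plane, ℂ)) (ξ : Plane) :
    𝓕 (conjSchwartz f) ξ = (starRingEnd ℂ) (𝓕 f (-ξ)) := by
  rw [SchwartzMap.fourier_coe, SchwartzMap.fourier_coe, Real.fourier_eq, Real.fourier_eq,
    ← integral_conj]
  refine MeasureTheory.integral_congr_ae (Filter.Eventually.of_forall fun x => ?_)
  simp only [Circle.smul_def, smul_eq_mul, map_mul, conjSchwartz_apply, inner_neg_right, neg_neg]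
  rw [← Circle.coe_inv_eq_conj, ← AddChar.map_neg_eq_inv]

/-- Conjugation commutes with `𝓕` up to the reflection `ξ ↦ -ξ`, which radial functions do not see.
-/
theorem IsHexSolution.add_conj {f : 𝓢(Plane, ℂ)} (hf : IsHexSolution f) :
    IsHexSolution (f + conjSchwartz f) := by
  obtain ⟨hF, hr, hv⟩ := hf
  refine ⟨?_, fun x y hxy => ?_, fun r hr => ?_⟩
  · ext ξ
    rw [FourierTransform.fourier_add, hF, add_apply, add_apply,
      fourier_conjSchwartz, hF, conjSchwartz_apply, hr (-ξ) ξ (norm_neg ξ)]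
  · rw [add_apply, add_apply, conjSchwartz_apply, conjSchwartz_apply, hr x y hxy]
  · obtain ⟨h0, h1⟩ := hv r hr
    have hp : profile (f + conjSchwartz f) =
        fun u => profile f u + (starRingEnd ℂ) (profile f u) := rfl
    rw [VanishesToOrderTwoAt, hp]
    refine ⟨by simp [h0], ?_⟩
    have h2 : HasDerivWithinAt (fun u => (starRingEnd ℂ) (profile f u))
        ((starRingEnd ℂ) 0) (Set.Ici 0) (r ^ 2) :=
      (Complex.conjCLE : ℂ →L[ℝ] ℂ).hasFDerivAt.comp_hasDerivWithinAt (r ^ 2) h1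
    refine (h1.add h2).congr_deriv (by simp)

theorem IsHexSolution.smul {f : 𝓢(Plane, ℂ)} (hf : IsHexSolution f) (c : ℂ) :
    IsHexSolution (c • f) := by
  obtain ⟨hF, hr, hv⟩ := hf
  refine ⟨by rw [FourierTransform.fourier_smul, hF], fun x y hxy => ?_, fun r hr => ?_⟩
  · rw [smul_apply, smul_apply, hr x y hxy]
  · obtain ⟨h0, h1⟩ := hv r hr
    have hp : profile (c • f) = fun u => c * profile f u := rfl
    rw [VanishesToOrderTwoAt, hp]
    refine ⟨by simp [h0], ?_⟩
    simpa using h1.const_mul c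

theorem isRealValued_add_conj (f : 𝓢(Plane, ℂ)) : IsRealValued (f + conjSchwartz f) := by
  intro x
  rw [add_apply, conjSchwartz_apply]
  simp

theorem IsHexSolution.exists_real {f : 𝓢(Plane, ℂ)} (hf : IsHexSolution f) (hne : f ≠ 0) :
    ∃ g : 𝓢(Plane, ℂ), IsHexSolution g ∧ IsRealValued g ∧ g ≠ 0 := by
  by_cases h1 : f + conjSchwartz f = 0
  -- Here `f` is purely imaginary, so `I • f` is real and its sum with its conjugate is nonzero.
  · refine ⟨_, (hf.smul Complex.I).add_conj, isRealValued_add_conj _, fun h2 => hne ?_⟩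
    ext x
    have e1 := congrArg (fun g : 𝓢(Plane, ℂ) => g x) h1
    have e2 := congrArg (fun g : 𝓢(Plane, ℂ) => g x) h2
    simp only [add_apply, conjSchwartz_apply, smul_apply, zero_apply, smul_eq_mul, map_mul,
      Complex.conj_I] at e1 e2
    have : Complex.I * (2 * f x) = 0 := by linear_combination e2 + Complex.I * e1
    simpa [Complex.I_ne_zero] using this
  · exact ⟨_, hf.add_conj, isRealValued_add_conj f, h1⟩

theorem VanishesToOrderTwoAt.sameFirstOrderDataAt_zero {f : 𝓢(Plane, ℂ)} {r : ℝ} (hr : 0 < r)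
    (h : VanishesToOrderTwoAt f r) : SameFirstOrderDataAt f 0 r := by
  have hp : profile (0 : 𝓢(Plane, ℂ)) = fun _ => 0 := rfl
  refine ⟨by rw [h.1, hp], ?_⟩
  rw [hp, deriv_const]
  exact (h.2.hasDerivAt (Ici_mem_nhds (by positivity))).deriv

theorem theorem1p6 :
    (∃ f : ℕ → 𝓢(Plane, ℂ), LinearIndependent ℂ f ∧
      ∀ i, IsRadial (f i) ∧
        ∀ r ∈ hexRadii, VanishesToOrderTwoAt (f i) r ∧ VanishesToOrderTwoAt (𝓕 (f i)) r) ∧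
    (∃ f g : 𝓢(Plane, ℂ), IsRadial f ∧ IsRadial g ∧ IsRealValued f ∧ IsRealValued g ∧ f ≠ g ∧
      ∀ r ∈ hexRadii, 0 < r → SameFirstOrderDataAt f g r ∧ SameFirstOrderDataAt (𝓕 f) (𝓕 g) r) := by
  obtain ⟨f, hli, hf⟩ := exists_linearIndependent_isHexSolution
  refine ⟨⟨f, hli, fun i => ⟨(hf i).2.1, fun r hr => ?_⟩⟩, ?_⟩
  · rw [(hf i).1]
    exact ⟨(hf i).2.2 r hr, (hf i).2.2 r hr⟩
  · obtain ⟨g, hg, hreal, hne⟩ := (hf 0).exists_real (hli.ne_zero 0)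
    refine ⟨g, 0, hg.2.1, fun _ _ _ => rfl, hreal, fun _ => rfl, hne, fun r hr hr0 => ?_⟩
    have h0 : 𝓕 (0 : 𝓢(Plane, ℂ)) = 0 := FourierTransform.fourier_zero
    rw [hg.1, h0]
    exact ⟨(hg.2.2 r hr).sameFirstOrderDataAt_zero hr0,
      (hg.2.2 r hr).sameFirstOrderDataAt_zero hr0⟩
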